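/- All graphs are finite and simple. In the game of Surrounding Cops and Robbers on a graph $G$ (perfect information), the first player places $m$ cops on vertices of $G$, then the second player places a robber on a vertex of $G$, and then the players alternate, the cops moving first. In a turn, each piece of the player to move stays where it is or moves to an adjacent vertex; several cops may share a vertex, and a cop may move onto the robber's vertex, but the robber may not end a turn on a vertex occupied by a cop. The cops win if at some point every neighbour of the robber's vertex is occupied by a cop; the robber wins if he prevents this forever. The surrounding cop number $s(G)$ is the least $m$ for which $m$ cops have a winning strategy on $G$. Theorem. Let $H$ be a graph and let $h \in V(H)$ be a vertex that has no neighbour of degree one, and suppose that $H$ has no isolated vertex other than possibly $h$. (Equivalently, $H-h$ has no isolated vertex.) If $G$ is a connected graph that does not contain $H$ as a minor, then $s(G) \le 3\,|E(H-h)|$. If $G$ is moreover bipartite, then $s(G) \le 2\,|E(H-h)|$. -/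

import Mathlib

namespace SurroundingGame

/-- A branch-set model of `H` in `G`: pairwise disjoint, non-empty, connected sets of vertices of
`G`, one for each vertex of `H`, such that adjacent vertices of `H` have branch sets joined by an
edge of `G`. -/
structure IsMinorModel {V W : Type*} (G : SimpleGraph V) (H : SimpleGraph W)
    (B : W → Set V) : Prop where
  connected : ∀ w, (G.induce (B w)).Connected
  disjoint : ∀ a b, a ≠ b → Disjoint (B a) (B b)
  adj : ∀ a b, H.Adj a b → ∃ x ∈ B a, ∃ y ∈ B b, G.Adj x y

/-- `G` contains `H` as a minor. -/
def HasMinor {V W : Type*} (G : SimpleGraph V) (H : SimpleGraph W) : Prop :=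
  ∃ B : W → Set V, IsMinorModel G H B

/-- In one turn a player's piece stays at its vertex or moves along an edge. -/
def Step {V : Type*} (G : SimpleGraph V) (u v : V) : Prop := u = v ∨ G.Adj u v

/-- A robber at `r` is surrounded by cops placed at `c` if every neighbour of `r` is occupied
by a cop. -/
def Surrounded {V : Type*} (G : SimpleGraph V) {m : ℕ} (c : Fin m → V) (r : V) : Prop :=
  ∀ v, G.Adj r v → ∃ i, c i = v

/-- A strategy for `m` cops in the game with perfect information. `pos l` is the placement of the
cops when it is the robber's turn and `l` lists the vertices that the robber has occupied at the
end of his previous turns, the most recent one first. So `pos []` is the initial placement, and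
`pos (v :: l)` is the cops' answer to the robber's choice of `v`. -/
structure CopStrategy {V : Type*} (G : SimpleGraph V) (m : ℕ) where
  pos : List V → Fin m → V
  step : ∀ l v i, Step G (pos l i) (pos (v :: l) i)

/-- The vertices chosen by the robber before his turn `t`, the most recent one first. -/
def history {V : Type*} (r : ℕ → V) : ℕ → List V
  | 0 => []
  | t + 1 => r t :: history r t

/-- The placement of the cops when the robber is about to make his choice `r t`. -/
def CopStrategy.copsAt {V : Type*} {G : SimpleGraph V} {m : ℕ} (σ : CopStrategy G m)
    (r : ℕ → V) (t : ℕ) : Fin m → V := σ.pos (history r t)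

/-- `r` is a legal play of the robber against `σ`: he starts anywhere at `r 0`, and in each later
turn he stays or moves to a neighbour, and may not end that turn on a vertex occupied by a cop.
A robber who has no legal move is surrounded, so infinite plays suffice. -/
def LegalPlay {V : Type*} {G : SimpleGraph V} {m : ℕ} (σ : CopStrategy G m) (r : ℕ → V) : Prop :=
  ∀ t, Step G (r t) (r (t + 1)) ∧ ∀ i, σ.copsAt r (t + 1) i ≠ r (t + 1)

/-- A strategy is winning if against every legal play the robber is surrounded at some point,
either just after his own move or just after the cops' answer to it. -/
def CopStrategy.IsWinning {V : Type*} {G : SimpleGraph V} {m : ℕ} (σ : CopStrategy G m) : Prop :=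
  ∀ r : ℕ → V, LegalPlay σ r →
    ∃ t, Surrounded G (σ.copsAt r t) (r t) ∨ Surrounded G (σ.copsAt r (t + 1)) (r t)

/-- `m` cops have a winning strategy on `G`. -/
def CopsWin {V : Type*} (G : SimpleGraph V) (m : ℕ) : Prop :=
  ∃ σ : CopStrategy G m, σ.IsWinning

/-- On a finite graph some number of cops wins: place one on each vertex. -/
theorem exists_copsWin {V : Type*} [Finite V] (G : SimpleGraph V) : ∃ m, CopsWin G m := by
  obtain ⟨n, ⟨e⟩⟩ := Finite.exists_equiv_fin V
  exact ⟨n, ⟨fun _ i => e.symm i, fun _ _ _ => Or.inl rfl⟩,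
    fun r _ => ⟨0, Or.inl fun v _ => ⟨e v, e.symm_apply_apply v⟩⟩⟩

open Classical in
/-- The surrounding cop number `s(G)` of a finite graph: the least number of cops that have a
winning strategy. -/
noncomputable def surroundingCopNumber {V : Type*} [Finite V] (G : SimpleGraph V) : ℕ :=
  Nat.find (exists_copsWin G)

end SurroundingGame

/-!
The robber is confined to a connected territory `R` whose boundary is guarded, and the territory
shrinks until it is gone. There is one group of cops for each edge of `H - h`, of three cops in
general and of two if `G` is bipartite.

*Guarding.* Let `x` be a vertex in or next to `R`, and project the robber to a shortest path that
starts at `x` and otherwise runs in `R`, by his distance to `x` in the graph induced on `R` and `x`.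
From a vertex next to a vertex of the path, the projection is at distance at most one from it along
the path, and exactly one if `G` is bipartite. Hence a group keeping at the offsets `-1, 0, 1`, or
`-1, 1`, from the projection occupies every vertex of the path that the robber could enter
(`PathGuard`). A group gathered at `x` gets into this position by advancing along the path without
ever giving up `x`, and the robber is then off the path (`Others.wins_of_climb`). A group guarding
a path can gather at one of its vertices while still guarding that vertex
(`Others.wins_of_gather`).

*Minor models.* Around `R` the cops maintain a partial model of `H - h` (`LinkSystem`): cores, which
are parts of the branch sets, and for some of the edges a guarded path joining the cores of its
ends, such that these paths, and single vertices carried by some other edges, contain the boundary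
of `R`. As `R` shrinks, the ends of the paths that no
longer touch `R` are absorbed into the cores, and the cores that no longer touch `R` are dropped
(`LinkSystem.exists_tight`). If every edge of `H - h` has its path, then every branch set is next
to `R`, since `H - h` has no isolated vertex, and with `R` as the branch set of `h` there is a model
of `H` (`LinkSystem.exists_model`). Otherwise the group of an edge without a path guards alone at
most one vertex, which lies in the core of an end of the edge. The group gathers there, or at any
other suitable vertex of a core if it is free, and takes up guarding a shortest path through `R` to
the core of the other end; if both cores are empty, it occupies a vertex of `R` as a new core
(`LinkSystem.extend`). What is left of `R` around the robber is smaller, and the argument repeats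
(`wins_of_confined`).
-/

namespace SurroundingGame

/-! ### Winning within a bounded number of rounds -/

/-- With the robber to move at `r` and the cops at `c`, the cops can play so that the robber runs
out of legal moves within `n` rounds. -/
def WinsWithin {V κ : Type*} (G : SimpleGraph V) : ℕ → (κ → V) → V → Prop
  | 0, _, _ => False
  | n + 1, c, r => ∀ r', Step G r r' → (∀ i, c i ≠ r') →
      ∃ c' : κ → V, (∀ i, Step G (c i) (c' i)) ∧ WinsWithin G n c' r'

/-- With the robber to move at `r` and the cops at `c`, the cops can play so that the robber
eventually runs out of legal moves. -/
def Wins {V κ : Type*} (G : SimpleGraph V) (c : κ → V) (r : V) : Prop :=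
  ∃ n, WinsWithin G n c r

theorem WinsWithin.succ {V κ : Type*} {G : SimpleGraph V} {n : ℕ} :
    ∀ {c : κ → V} {r : V}, WinsWithin G n c r → WinsWithin G (n + 1) c r := by
  induction n with
  | zero => intro c r h; exact h.elim
  | succ n ih =>
    intro c r h r' hr hc
    obtain ⟨c', hs, hw⟩ := h r' hr hc
    exact ⟨c', hs, ih hw⟩

theorem WinsWithin.mono {V κ : Type*} {G : SimpleGraph V} {n m : ℕ} (hnm : n ≤ m)
    {c : κ → V} {r : V} (h : WinsWithin G n c r) : WinsWithin G m c r := by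
  induction hnm with
  | refl => exact h
  | step _ ih => exact ih.succ

/-- Since the robber has finitely many options, the numbers of rounds needed after each of them
have a common bound. -/
theorem Wins.of_forall {V κ : Type*} [Finite V] {G : SimpleGraph V} {c : κ → V} {r : V}
    (h : ∀ r', Step G r r' → (∀ i, c i ≠ r') →
      ∃ c' : κ → V, (∀ i, Step G (c i) (c' i)) ∧ Wins G c' r') : Wins G c r := by
  have h' : ∀ r', ∃ n, Step G r r' → (∀ i, c i ≠ r') →
      ∃ c' : κ → V, (∀ i, Step G (c i) (c' i)) ∧ WinsWithin G n c' r' := by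
    intro r'
    by_cases hr : Step G r r' ∧ ∀ i, c i ≠ r'
    · obtain ⟨c', hs, n, hn⟩ := h r' hr.1 hr.2
      exact ⟨n, fun _ _ => ⟨c', hs, hn⟩⟩
    · exact ⟨0, fun h₁ h₂ => (hr ⟨h₁, h₂⟩).elim⟩
  choose n hn using h'
  obtain ⟨N, hN⟩ := (Set.finite_range n).bddAbove
  refine ⟨N + 1, fun r' hr hc => ?_⟩
  obtain ⟨c', hs, hw⟩ := hn r' hr hc
  exact ⟨c', hs, hw.mono (hN ⟨r', rfl⟩)⟩

open Classical in
/-- An answer of the cops at `c` to the robber's move to `v` after which they win within `n`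
rounds, if there is one. -/
noncomputable def reply {V κ : Type*} (G : SimpleGraph V) (n : ℕ) (c : κ → V) (v : V) : κ → V :=
  if h : ∃ c' : κ → V, (∀ i, Step G (c i) (c' i)) ∧ WinsWithin G n c' v then h.choose else c

theorem reply_step {V κ : Type*} (G : SimpleGraph V) (n : ℕ) (c : κ → V) (v : V) (i : κ) :
    Step G (c i) (reply G n c v i) := by
  unfold reply
  split_ifs with h
  · exact h.choose_spec.1 i
  · exact Or.inl rfl

theorem reply_winsWithin {V κ : Type*} {G : SimpleGraph V} {n : ℕ} {c : κ → V} {v : V}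
    (h : ∃ c' : κ → V, (∀ i, Step G (c i) (c' i)) ∧ WinsWithin G n c' v) :
    WinsWithin G n (reply G n c v) v := by
  unfold reply
  rw [dif_pos h]
  exact h.choose_spec.2

/-- The placement of the cops after a given history when they start at `c₀` and aim at winning
within `N` rounds. -/
noncomputable def boundedPos {V κ : Type*} (G : SimpleGraph V) (N : ℕ) (c₀ : κ → V) :
    List V → κ → V
  | [] => c₀
  | v :: l => reply G (N - l.length) (boundedPos G N c₀ l) v

theorem length_history {V : Type*} (r : ℕ → V) (t : ℕ) : (history r t).length = t := by
  induction t with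
  | zero => rfl
  | succ t ih => simp [history, ih]

/-- If from some placement the cops make the robber run out of moves wherever he starts, they have
a winning strategy: against it there is no legal infinite play. -/
theorem copsWin_of_wins {V κ : Type*} [Finite V] {G : SimpleGraph V} {m : ℕ} (e : Fin m ≃ κ)
    (c₀ : κ → V) (h : ∀ r, Wins G c₀ r) : CopsWin G m := by
  choose n hn using h
  obtain ⟨N, hN⟩ := (Set.finite_range n).bddAbove
  refine ⟨⟨fun l i => boundedPos G N c₀ l (e i), fun l v i => reply_step G _ _ v _⟩, ?_⟩
  intro r hr
  exfalso
  have key : ∀ t, WinsWithin G (N - t) (boundedPos G N c₀ (history r (t + 1))) (r t) := by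
    intro t
    induction t with
    | zero => exact reply_winsWithin ⟨c₀, fun _ => Or.inl rfl, (hn (r 0)).mono (hN ⟨r 0, rfl⟩)⟩
    | succ t ih =>
      obtain ⟨hs, hc⟩ := hr t
      rcases hk : N - t with _ | k
      · rw [hk] at ih; exact ih.elim
      · have hk' : N - (t + 1) = k := by omega
        have hlen := length_history r (t + 1)
        rw [hk] at ih
        have := ih (r (t + 1)) hs (fun i => by
          simpa [CopStrategy.copsAt] using hc (e.symm i))
        rw [hk', history, boundedPos, hlen, hk']
        exact reply_winsWithin this
  simpa [WinsWithin] using key N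

/-! ### Guarding a path by the shadow of the robber -/

/-- The point of the interval `[a, b]` closest to `z`. -/
def clip (a b z : ℤ) : ℤ := max a (min b z)

/-- The data by which a group of cops, one for each `l : J`, guards the vertices of `K` on the path
`p 0, …, p k` against a robber in the territory `R`. The function `d` projects the robber to the
path, and cop `l` keeps the distance `off l` from the projection, as far as the path reaches. By
`block`, a robber in `R` next to a vertex of `K` finds a cop there. -/
structure PathGuard {V J : Type*} (G : SimpleGraph V) (off : J → ℤ) (R K : Set V)
    (p : ℤ → V) (k : ℤ) (d : V → ℤ) : Prop where
  nonneg : 0 ≤ k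
  adj : ∀ z, 0 ≤ z → z < k → G.Adj (p z) (p (z + 1))
  lip : ∀ u ∈ R, ∀ v ∈ R, G.Adj u v → |d u - d v| ≤ 1
  sub : ∀ v ∈ K, ∃ z, 0 ≤ z ∧ z ≤ k ∧ p z = v
  block : ∀ u ∈ R, ∀ z, 0 ≤ z → z ≤ k → p z ∈ K → G.Adj u (p z) → ∃ l, off l = z - d u

/-- The positions of a group of cops guarding a path when the robber is at `r`. -/
def shadow {V J : Type*} (off : J → ℤ) (p : ℤ → V) (k : ℤ) (d : V → ℤ) (r : V) (l : J) : V :=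
  p (clip 0 k (d r + off l))

theorem PathGuard.mono {V J : Type*} {G : SimpleGraph V} {off : J → ℤ} {R R' K : Set V}
    {p : ℤ → V} {k : ℤ} {d : V → ℤ} (h : PathGuard G off R K p k d) (hR : R' ⊆ R) :
    PathGuard G off R' K p k d :=
  ⟨h.nonneg, h.adj, fun u hu v hv => h.lip u (hR hu) v (hR hv), h.sub,
    fun u hu => h.block u (hR hu)⟩

theorem PathGuard.lip_of_step {V J : Type*} {G : SimpleGraph V} {off : J → ℤ} {R K : Set V}
    {p : ℤ → V} {k : ℤ} {d : V → ℤ} (h : PathGuard G off R K p k d) {u v : V} (hu : u ∈ R)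
    (hv : v ∈ R) (huv : Step G u v) : |d u - d v| ≤ 1 := by
  rcases huv with rfl | huv
  · simp
  · exact h.lip u hu v hv huv

theorem PathGuard.step {V J : Type*} {G : SimpleGraph V} {off : J → ℤ} {R K : Set V}
    {p : ℤ → V} {k : ℤ} {d : V → ℤ} (h : PathGuard G off R K p k d) {y z : ℤ}
    (hy : 0 ≤ y) (hyk : y ≤ k) (hz : 0 ≤ z) (hzk : z ≤ k) (hyz : |y - z| ≤ 1) :
    Step G (p y) (p z) := by
  rw [abs_le] at hyz
  have : z = y ∨ z = y + 1 ∨ y = z + 1 := by omega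
  rcases this with rfl | rfl | rfl
  · exact Or.inl rfl
  · exact Or.inr (h.adj y hy (by omega))
  · exact Or.inr (h.adj z hz (by omega)).symm

/-- A group may follow the robber in one turn while the parts of the path to which its cops are
confined change by one vertex at each end. -/
theorem PathGuard.step_clip {V J : Type*} {G : SimpleGraph V} {off : J → ℤ} {R K : Set V}
    {p : ℤ → V} {k : ℤ} {d : V → ℤ} (h : PathGuard G off R K p k d) {u v : V} (hu : u ∈ R)
    (hv : v ∈ R) (huv : Step G u v) (l : J) {a b a' b' : ℤ} (ha : 0 ≤ a) (hb : b ≤ k)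
    (hab : a ≤ b) (ha' : 0 ≤ a') (hb' : b' ≤ k) (hab' : a' ≤ b') (haa : |a - a'| ≤ 1)
    (hbb : |b - b'| ≤ 1) :
    Step G (p (clip a b (d u + off l))) (p (clip a' b' (d v + off l))) := by
  have hd := h.lip_of_step hu hv huv
  rw [abs_le] at hd haa hbb
  unfold clip
  exact h.step (by omega) (by omega) (by omega) (by omega) (by rw [abs_le]; omega)

theorem PathGuard.step_shadow {V J : Type*} {G : SimpleGraph V} {off : J → ℤ} {R K : Set V}
    {p : ℤ → V} {k : ℤ} {d : V → ℤ} (h : PathGuard G off R K p k d) {u v : V} (hu : u ∈ R)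
    (hv : v ∈ R) (huv : Step G u v) (l : J) :
    Step G (shadow off p k d u l) (shadow off p k d v l) :=
  h.step_clip hu hv huv l le_rfl le_rfl h.nonneg le_rfl le_rfl h.nonneg (by simp) (by simp)

theorem PathGuard.exists_shadow_eq {V J : Type*} {G : SimpleGraph V} {off : J → ℤ} {R K : Set V}
    {p : ℤ → V} {k : ℤ} {d : V → ℤ} (h : PathGuard G off R K p k d) {u v : V} (hu : u ∈ R)
    (hv : v ∈ K) (huv : G.Adj u v) : ∃ l, shadow off p k d u l = v := by
  obtain ⟨z, hz, hzk, rfl⟩ := h.sub v hv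
  obtain ⟨l, hl⟩ := h.block u hu z hz hzk hv huv
  refine ⟨l, ?_⟩
  unfold shadow clip
  congr 1
  omega

/-! ### Redeploying one group of cops -/

open Classical in
/-- The placement in which group `i` is at `c` and every other group `j` is at the positions `g j r`
answering a robber at `r`. -/
noncomputable def deploy {V ι J : Type*} (g : ι → V → J → V) (i : ι) (c : J → V) (r : V) :
    ι × J → V :=
  fun q => if q.1 = i then c q.2 else g q.1 r q.2

/-- The groups `j` other than `i` follow a robber in `R`, each guarding its set `K j`. If `esc` holds,
he may leave `R` past them through the vertex `x`; otherwise they keep him in `R` by themselves. -/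
structure Others {V ι J : Type*} (G : SimpleGraph V) (R : Set V) (K : ι → Set V)
    (g : ι → V → J → V) (i : ι) (x : V) (esc : Prop) : Prop where
  follow : ∀ j, j ≠ i → ∀ u ∈ R, ∀ v ∈ R, Step G u v → ∀ l, Step G (g j u l) (g j v l)
  block : ∀ j, j ≠ i → ∀ u ∈ R, ∀ v ∈ K j, G.Adj u v → ∃ l, g j u l = v
  exit : ∀ u ∈ R, ∀ v, v ∉ R → G.Adj u v → (∃ j, j ≠ i ∧ v ∈ K j) ∨ (esc ∧ v = x)

theorem Others.wins_of_round {V ι J : Type*} [Finite V] {G : SimpleGraph V} {R : Set V}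
    {K : ι → Set V} {g : ι → V → J → V} {i : ι} {x : V} {esc : Prop}
    (ho : Others G R K g i x esc) {c : J → V} {r : V} (hr : r ∈ R)
    (hx : esc → G.Adj r x → ∃ l, c l = x)
    (h : ∀ r' ∈ R, Step G r r' → (∀ l, c l ≠ r') →
      ∃ c' : J → V, (∀ l, Step G (c l) (c' l)) ∧ Wins G (deploy g i c' r') r') :
    Wins G (deploy g i c r) r := by
  refine Wins.of_forall fun r' hs hc => ?_
  have hci : ∀ l, c l ≠ r' := fun l => by simpa [deploy] using hc (i, l)
  have hr' : r' ∈ R := by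
    by_contra hr'
    rcases hs with rfl | hadj
    · exact hr' hr
    rcases ho.exit r hr r' hr' hadj with ⟨j, hj, hK⟩ | ⟨he, rfl⟩
    · obtain ⟨l, hl⟩ := ho.block j hj r hr r' hK hadj
      exact hc (j, l) (by simpa [deploy, hj] using hl)
    · obtain ⟨l, hl⟩ := hx he hadj
      exact hci l hl
  obtain ⟨c', hc', hw⟩ := h r' hr' hs hci
  refine ⟨_, fun q => ?_, hw⟩
  by_cases hq : q.1 = i
  · simpa [deploy, hq] using hc' q.2
  · simpa [deploy, hq] using ho.follow q.1 hq r hr r' hr' hs q.2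

/-- A group guarding a path can gather at one of its vertices without giving up that vertex: the
part of the path that it guards shrinks by a vertex at each end in each turn. -/
theorem Others.wins_of_gather {V ι J : Type*} [Finite V] {G : SimpleGraph V} {R : Set V}
    {K : ι → Set V} {g : ι → V → J → V} {i : ι} {x : V} {esc : Prop}
    (ho : Others G R K g i x esc) {off : J → ℤ} {L : Set V} {p : ℤ → V} {k : ℤ} {d : V → ℤ}
    (hp : PathGuard G off R L p k d) (hx : x ∈ L)
    (h : ∀ r ∈ R, Wins G (deploy g i (fun _ => x) r) r) {r : V} (hr : r ∈ R) :
    Wins G (deploy g i (shadow off p k d r) r) r := by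
  obtain ⟨z, hz, hzk, rfl⟩ := hp.sub x hx
  have key : ∀ n : ℕ, ∀ τ : ℤ, 0 ≤ τ → k - τ ≤ n → ∀ r ∈ R, Wins G (deploy g i
      (fun l => p (clip (min τ z) (max (k - τ) z) (d r + off l))) r) r := by
    intro n
    induction n with
    | zero =>
      intro τ hτ hn r hr
      convert h r hr using 5
      unfold clip
      omega
    | succ n ih =>
      intro τ hτ hn r hr
      refine ho.wins_of_round hr (fun _ hadj => ?_) fun r' hr' hs _ => ?_
      · obtain ⟨l, hl⟩ := hp.block r hr z hz hzk hx hadj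
        refine ⟨l, ?_⟩
        unfold clip
        congr 1
        omega
      · refine ⟨_, fun l => ?_, ih (τ + 1) (by omega) (by omega) r' hr'⟩
        exact hp.step_clip hr hr' hs l (by omega) (by omega) (by omega) (by omega) (by omega)
          (by omega) (by rw [abs_le]; omega) (by rw [abs_le]; omega)
  have := key k.toNat 0 le_rfl (by omega) r hr
  convert this using 5
  unfold shadow
  congr 2 <;> omega

/-- A group that guards nothing the others do not guard can gather at any vertex. -/
theorem Others.wins_of_walk {V ι J : Type*} [Finite V] [Finite J] {G : SimpleGraph V}
    (hG : G.Connected) {R : Set V} {K : ι → Set V} {g : ι → V → J → V} {i : ι} {x : V}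
    {esc : Prop} (ho : Others G R K g i x esc) (hesc : ¬ esc)
    (h : ∀ r ∈ R, Wins G (deploy g i (fun _ => x) r) r) (c : J → V) {r : V} (hr : r ∈ R) :
    Wins G (deploy g i c r) r := by
  have key : ∀ n : ℕ, ∀ c : J → V, (∀ l, G.dist (c l) x ≤ n) → ∀ r ∈ R,
      Wins G (deploy g i c r) r := by
    intro n
    induction n with
    | zero =>
      intro c hc r hr
      have : c = fun _ => x := funext fun l => (hG.dist_eq_zero_iff).1 (by have := hc l; omega)
      exact this ▸ h r hr
    | succ n ih =>
      intro c hc r hr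
      have hstep : ∀ l, ∃ v, Step G (c l) v ∧ G.dist v x ≤ n := by
        intro l
        by_cases hl : G.dist (c l) x ≤ n
        · exact ⟨c l, Or.inl rfl, hl⟩
        obtain ⟨w, hw⟩ := hG.exists_walk_length_eq_dist (c l) x
        cases w with
        | nil => simp at hl
        | cons hadj w =>
          refine ⟨_, Or.inr hadj, ?_⟩
          have h₁ := SimpleGraph.dist_le w
          have h₂ := hc l
          rw [SimpleGraph.Walk.length_cons] at hw
          omega
      choose c' hc' hd using hstep
      exact ho.wins_of_round hr (fun he => (hesc he).elim)
        fun r' hr' _ _ => ⟨c', hc', ih c' hd r' hr'⟩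
  obtain ⟨N, hN⟩ := (Set.finite_range fun l => G.dist (c l) x).bddAbove
  exact key N c (fun l => hN ⟨l, rfl⟩) r hr

/-- A group gathered at the first vertex `x` of a geodesic can take up guarding the geodesic without
giving up `x`, and such that the robber is off the geodesic when it is guarded. The cops ahead of
the projection of the robber wait at `x` until the others are in place. -/
theorem Others.wins_of_climb {V ι J : Type*} [Finite V] {G : SimpleGraph V} {R : Set V}
    {K : ι → Set V} {g : ι → V → J → V} {i : ι} {x : V} {esc : Prop}
    (ho : Others G R K g i x esc) {off : J → ℤ} (hoff : ∀ l, |off l| ≤ 1) (hone : ∃ l, off l = 1)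
    {p : ℤ → V} {k : ℤ} {d : V → ℤ} (hp : PathGuard G off R (p '' Set.Icc 0 k) p k d)
    (hx : p 0 = x) (hdp : ∀ z, 0 ≤ z → z ≤ k → d (p z) = z) (hd : ∀ u ∈ R, 0 ≤ d u)
    (hd0 : ∀ u ∈ R, d u = 0 → u = x)
    (h : ∀ r ∈ R, r ∉ p '' Set.Icc 0 k → Wins G (deploy g i (shadow off p k d r) r) r)
    {r : V} (hr : r ∈ R) : Wins G (deploy g i (fun _ => x) r) r := by
  have hk := hp.nonneg
  have hoff' : ∀ l, -1 ≤ off l ∧ off l ≤ 1 := fun l => abs_le.1 (hoff l)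
  -- A robber next to `x` has projection `p 1`, so the cops one behind the projection are at `x`.
  have hxl : ∀ r ∈ R, G.Adj r x → ∃ l, off l = -1 ∧ d r = 1 := by
    intro r hr hadj
    obtain ⟨l, hl⟩ := hp.block r hr 0 le_rfl hk ⟨0, ⟨le_rfl, hk⟩, rfl⟩ (hx ▸ hadj)
    have h₁ := hd r hr
    have h₂ : d r ≠ 0 := fun h0 => hadj.ne (hd0 r hr h0)
    have h₃ := hoff' l
    exact ⟨l, by omega, by omega⟩
  -- The group is in place, and the robber is off the path or has to leave it.
  have final : ∀ r ∈ R, (r ∈ p '' Set.Icc 0 k → ∃ l, shadow off p k d r l = r) →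
      Wins G (deploy g i (shadow off p k d r) r) r := by
    intro r hr hocc
    by_cases hrP : r ∈ p '' Set.Icc 0 k
    swap
    · exact h r hr hrP
    refine ho.wins_of_round hr (fun _ hadj => ?_) fun r' hr' hs hl => ?_
    · exact hp.exists_shadow_eq hr ⟨0, ⟨le_rfl, hk⟩, hx⟩ hadj
    · refine ⟨_, fun l => hp.step_shadow hr hr' hs l, h r' hr' fun hrP' => ?_⟩
      rcases hs with rfl | hadj
      · obtain ⟨l, hl'⟩ := hocc hrP
        exact hl l hl'
      · obtain ⟨l, hl'⟩ := hp.exists_shadow_eq hr hrP' hadj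
        exact hl l hl'
  -- The cops ahead of the projection advance. When they reach their places for the first time, a
  -- robber on the path shares his vertex with a cop.
  have ahead : ∀ n : ℕ, ∀ τ : ℤ, 0 ≤ τ → τ + n = k → ∀ r ∈ R,
      (r ∈ p '' Set.Icc 0 k → min (d r + 1) k ≤ τ →
        ∃ l, p (clip 0 (if off l = 1 then τ else k) (d r + off l)) = r) →
      Wins G (deploy g i
        (fun l => p (clip 0 (if off l = 1 then τ else k) (d r + off l))) r) r := by
    intro n
    induction n with
    | zero =>
      intro τ hτ hn r hr hI
      obtain rfl : τ = k := by simpa using hn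
      simp only [ite_self] at hI ⊢
      exact final r hr fun hP => hI hP (min_le_right _ _)
    | succ n ih =>
      intro τ hτ hn r hr hI
      push_cast at hn
      refine ho.wins_of_round hr (fun _ hadj => ?_) fun r' hr' hs hl => ?_
      · obtain ⟨l, hl, hdr⟩ := hxl r hr hadj
        refine ⟨l, ?_⟩
        rw [if_neg (by omega), ← hx]
        unfold clip
        congr 1
        omega
      refine ⟨_, fun l => ?_, ih (τ + 1) (by omega) (by omega) r' hr' ?_⟩
      · refine hp.step_clip hr hr' hs l le_rfl ?_ ?_ le_rfl ?_ ?_ (by simp) ?_ <;>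
          split_ifs <;> (try rw [abs_le]) <;> omega
      rintro ⟨z, ⟨hz, hzk⟩, rfl⟩ hmin
      rw [hdp z hz hzk] at hmin ⊢
      obtain ⟨b, hb⟩ := hone
      have hlb := hl b
      rw [if_pos hb, hb] at hlb
      have hzr : z = d r ∨ z = d r + 1 := by
        rcases hs with rfl | hadj
        · exact Or.inl (hdp z hz hzk).symm
        · obtain ⟨l, hl'⟩ := hp.block r hr z hz hzk ⟨z, ⟨hz, hzk⟩, rfl⟩ hadj
          by_cases h1 : off l = 1
          · exact Or.inr (by omega)
          · refine (hl l ?_).elim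
            rw [if_neg h1]
            unfold clip
            congr 1
            omega
      by_cases hend : k = z ∧ τ + 1 = z
      · refine ⟨b, ?_⟩
        rw [if_pos hb]
        unfold clip
        congr 1
        omega
      exfalso
      rcases hzr with hzr | hzr
      · by_cases hτz : τ = z
        · refine hlb ?_
          unfold clip
          congr 1
          omega
        · have hmin' : min (d r + 1) k ≤ τ := by omega
          have hrz : r = p z := by
            rcases hs with hs | hadj
            · exact hs
            · obtain ⟨l, hl'⟩ := hp.block r hr z hz hzk ⟨z, ⟨hz, hzk⟩, rfl⟩ hadj
              refine (hl l ?_).elim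
              rw [if_neg (by omega)]
              unfold clip
              congr 1
              omega
          obtain ⟨l, hl'⟩ := hI (hrz ▸ ⟨z, ⟨hz, hzk⟩, rfl⟩) hmin'
          exact hl l (hl'.trans hrz)
      · refine hlb ?_
        unfold clip
        congr 1
        omega
  -- The other cops advance.
  have behind : ∀ n : ℕ, ∀ τ : ℤ, 0 ≤ τ → τ + n = k → ∀ r ∈ R,
      Wins G (deploy g i
        (fun l => p (clip 0 (if off l = 1 then 0 else τ) (d r + off l))) r) r := by
    intro n
    induction n with
    | zero =>
      intro τ hτ hn r hr
      obtain rfl : τ = k := by simpa using hn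
      refine ahead τ.toNat 0 le_rfl (by omega) r hr ?_
      rintro ⟨z, ⟨hz, hzk⟩, rfl⟩ hmin
      rw [hdp z hz hzk] at hmin ⊢
      obtain ⟨b, hb⟩ := hone
      refine ⟨b, ?_⟩
      rw [if_pos hb]
      unfold clip
      congr 1
      omega
    | succ n ih =>
      intro τ hτ hn r hr
      push_cast at hn
      refine ho.wins_of_round hr (fun _ _ => ?_) fun r' hr' hs _ => ?_
      · obtain ⟨b, hb⟩ := hone
        refine ⟨b, ?_⟩
        rw [if_pos hb, ← hx]
        unfold clip
        congr 1
        omega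
      · refine ⟨_, fun l => ?_, ih (τ + 1) (by omega) (by omega) r' hr'⟩
        refine hp.step_clip hr hr' hs l le_rfl ?_ ?_ le_rfl ?_ ?_ (by simp) ?_ <;>
          split_ifs <;> (try rw [abs_le]) <;> omega
  convert behind k.toNat 0 le_rfl (by omega) r hr using 5
  rw [← hx, ite_self]
  unfold clip
  congr 1
  omega

/-! ### Connected sets and boundaries -/

/-- Any two vertices of `A` are joined by a walk inside `A`. Unlike connectedness of the induced
subgraph, this involves no subtype; the empty set is linked. -/
def Linked {V : Type*} (G : SimpleGraph V) (A : Set V) : Prop :=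
  ∀ a ∈ A, ∀ b ∈ A, Relation.ReflTransGen (fun x y => G.Adj x y ∧ x ∈ A ∧ y ∈ A) a b

/-- The vertices outside `R` with a neighbour in `R`. -/
def boundary {V : Type*} (G : SimpleGraph V) (R : Set V) : Set V :=
  {v | v ∉ R ∧ ∃ r ∈ R, G.Adj r v}

theorem reflTransGen_adj_symm {V : Type*} {G : SimpleGraph V} {A : Set V} {a b : V}
    (h : Relation.ReflTransGen (fun x y => G.Adj x y ∧ x ∈ A ∧ y ∈ A) a b) :
    Relation.ReflTransGen (fun x y => G.Adj x y ∧ x ∈ A ∧ y ∈ A) b a := by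
  induction h with
  | refl => exact .refl
  | tail _ h ih => exact .head ⟨h.1.symm, h.2.2, h.2.1⟩ ih

theorem reflTransGen_adj_mono {V : Type*} {G : SimpleGraph V} {A B : Set V} (hAB : A ⊆ B)
    {a b : V} (h : Relation.ReflTransGen (fun x y => G.Adj x y ∧ x ∈ A ∧ y ∈ A) a b) :
    Relation.ReflTransGen (fun x y => G.Adj x y ∧ x ∈ B ∧ y ∈ B) a b :=
  h.lift id fun _ _ h => ⟨h.1, hAB h.2.1, hAB h.2.2⟩

/-- A set is linked if all its vertices are joined inside it to a linked subset. -/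
theorem Linked.of_anchored {V : Type*} {G : SimpleGraph V} {C A : Set V} (hC : Linked G C)
    (hCA : C ⊆ A) (h : ∀ v ∈ A, ∃ c ∈ C,
      Relation.ReflTransGen (fun x y => G.Adj x y ∧ x ∈ A ∧ y ∈ A) v c) : Linked G A := by
  intro a ha b hb
  obtain ⟨c, hc, hac⟩ := h a ha
  obtain ⟨c', hc', hbc⟩ := h b hb
  exact (hac.trans (reflTransGen_adj_mono hCA (hC c hc c' hc'))).trans
    (reflTransGen_adj_symm hbc)

theorem Linked.insert {V : Type*} {G : SimpleGraph V} {C : Set V} (hC : Linked G C) {x y : V}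
    (hx : x ∈ C) (hxy : G.Adj y x) : Linked G (insert y C) := by
  refine hC.of_anchored (Set.subset_insert _ _) fun v hv => ?_
  rcases hv with rfl | hv
  · exact ⟨x, hx, .single ⟨hxy, Or.inl rfl, Or.inr hx⟩⟩
  · exact ⟨v, hv, .refl⟩

theorem linked_singleton {V : Type*} {G : SimpleGraph V} (x : V) : Linked G {x} := by
  rintro a rfl b rfl
  exact .refl

theorem Linked.connected {V : Type*} {G : SimpleGraph V} {A : Set V} (hA : Linked G A)
    (hne : A.Nonempty) : (G.induce A).Connected := by
  obtain ⟨x, hx⟩ := hne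
  have key : ∀ b, Relation.ReflTransGen (fun x y => G.Adj x y ∧ x ∈ A ∧ y ∈ A) x b →
      ∀ hb : b ∈ A, (G.induce A).Reachable ⟨x, hx⟩ ⟨b, hb⟩ := by
    intro b h
    induction h with
    | refl => intro _; exact .rfl
    | tail _ h ih =>
      intro hb
      exact (ih h.2.1).trans (SimpleGraph.Adj.reachable (G := G.induce A) h.1)
  refine (SimpleGraph.connected_iff_exists_forall_reachable _).2 ⟨⟨x, hx⟩, ?_⟩
  rintro ⟨b, hb⟩
  exact key b (hA x hx b hb) hb

/-! ### Partial minor models around the territory of the robber -/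

/-- A partial minor model around the territory `R`, for a graph whose edges are listed by `edge`.
The core `C w` is the part already fixed of the branch set of `w`; it may be empty. The edge `i`
carries the vertices `p i z` with `lo i ≤ z ≤ hi i`, all of them in the guarded set `K i`.
If `lo i < hi i`, they form a path from the core of `s i` to the core of `t i` whose inner vertices
belong to nothing else; if `lo i = hi i`, it is a single vertex of one of these cores; and if
`hi i < lo i`, there is none. Together they contain the boundary of `R`. -/
structure LinkSystem {V ι U : Type*} (G : SimpleGraph V) (edge : ι → Sym2 U) (R : Set V)
    (K : ι → Set V) (s t : ι → U) (C : U → Set V) (p : ι → ℤ → V) (lo hi : ι → ℤ) : Prop where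
  ends : ∀ i, s(s i, t i) = edge i
  linked : ∀ w, Linked G (C w)
  disjoint : ∀ a b v, v ∈ C a → v ∈ C b → a = b
  avoid : ∀ w, ∀ v ∈ C w, v ∉ R
  left : ∀ i, lo i < hi i → p i (lo i) ∈ C (s i)
  right : ∀ i, lo i < hi i → p i (hi i) ∈ C (t i)
  single : ∀ i, lo i = hi i → p i (lo i) ∈ C (s i) ∨ p i (lo i) ∈ C (t i)
  adj : ∀ i z, lo i ≤ z → z < hi i → G.Adj (p i z) (p i (z + 1))
  inner_core : ∀ i z, lo i < z → z < hi i → ∀ w, p i z ∉ C w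
  inner_avoid : ∀ i z, lo i < z → z < hi i → p i z ∉ R
  inner_inj : ∀ i z j y, lo i < z → z < hi i → lo j < y → y < hi j → p i z = p j y →
    i = j ∧ z = y
  cover : ∀ v ∈ boundary G R, ∃ i z, lo i ≤ z ∧ z ≤ hi i ∧ p i z = v
  guarded : ∀ i z, lo i ≤ z → z ≤ hi i → p i z ∈ K i

/-- The cores enlarged by the inner vertices of the paths up to position `lo'`, joined to the core
at the start, and those from position `hi'` on, joined to the core at the end. -/
def absorb {V ι U : Type*} (s t : ι → U) (C : U → Set V) (p : ι → ℤ → V) (lo hi lo' hi' : ι → ℤ)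
    (w : U) : Set V :=
  {v | v ∈ C w ∨ ∃ i z, lo i < z ∧ z < hi i ∧ p i z = v ∧
    (z ≤ lo' i ∧ w = s i ∨ lo' i < z ∧ hi' i ≤ z ∧ w = t i)}

/-- Around `R` there is a minor model of the graph whose edges are listed by `edge`: disjoint linked
branch sets outside `R`, each of them next to `R`, with the ends of every edge joined. -/
def HasModelAround {V ι U : Type*} (G : SimpleGraph V) (edge : ι → Sym2 U) (R : Set V) : Prop :=
  ∃ B : U → Set V, (∀ w, Linked G (B w)) ∧ (∀ a b v, v ∈ B a → v ∈ B b → a = b) ∧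
    (∀ w, ∀ v ∈ B w, v ∉ R) ∧ (∀ w, ∃ x ∈ B w, ∃ r ∈ R, G.Adj r x) ∧
    ∀ i a b, edge i = s(a, b) → ∃ x ∈ B a, ∃ y ∈ B b, G.Adj x y

section LinkSystem

variable {V ι U : Type*} {G : SimpleGraph V} {edge : ι → Sym2 U} {R : Set V} {K : ι → Set V}
  {s t : ι → U} {C : U → Set V} {p : ι → ℤ → V} {lo hi : ι → ℤ}

theorem LinkSystem.linked_absorb (h : LinkSystem G edge R K s t C p lo hi) (lo' hi' : ι → ℤ)
    (w : U) : Linked G (absorb s t C p lo hi lo' hi' w) := by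
  have hsub : C w ⊆ absorb s t C p lo hi lo' hi' w := fun v hv => Or.inl hv
  refine (h.linked w).of_anchored hsub ?_
  rintro v (hv | ⟨i, z, hz, hz', rfl, ⟨hz₁, rfl⟩ | ⟨hz₁, hz₂, rfl⟩⟩)
  · exact ⟨v, hv, .refl⟩
  · refine ⟨p i (lo i), h.left i (by omega), ?_⟩
    have key : ∀ n : ℕ, ∀ y, y = lo i + n → y ≤ z → Relation.ReflTransGen
        (fun a b => G.Adj a b ∧ a ∈ absorb s t C p lo hi lo' hi' (s i) ∧
          b ∈ absorb s t C p lo hi lo' hi' (s i)) (p i y) (p i (lo i)) := by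
      have hmem : ∀ y, lo i ≤ y → y ≤ z → p i y ∈ absorb s t C p lo hi lo' hi' (s i) := by
        intro y hy hyz
        rcases hy.eq_or_lt with rfl | hy
        · exact Or.inl (h.left i (by omega))
        · exact Or.inr ⟨i, y, hy, by omega, rfl, Or.inl ⟨by omega, rfl⟩⟩
      intro n
      induction n with
      | zero => intro y hy _; simp only [Nat.cast_zero, add_zero] at hy; rw [hy]
      | succ n ih =>
        intro y hy hyz
        push_cast at hy
        refine .head ⟨?_, hmem y (by omega) hyz, hmem (y - 1) (by omega) (by omega)⟩
          (ih (y - 1) (by omega) (by omega))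
        have := h.adj i (y - 1) (by omega) (by omega)
        rw [sub_add_cancel] at this
        exact this.symm
    exact key (z - lo i).toNat z (by omega) le_rfl
  · refine ⟨p i (hi i), h.right i (by omega), ?_⟩
    have key : ∀ n : ℕ, ∀ y, y = hi i - n → z ≤ y → Relation.ReflTransGen
        (fun a b => G.Adj a b ∧ a ∈ absorb s t C p lo hi lo' hi' (t i) ∧
          b ∈ absorb s t C p lo hi lo' hi' (t i)) (p i y) (p i (hi i)) := by
      have hmem : ∀ y, z ≤ y → y ≤ hi i → p i y ∈ absorb s t C p lo hi lo' hi' (t i) := by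
        intro y hy hyz
        rcases hyz.eq_or_lt with rfl | hyz
        · exact Or.inl (h.right i (by omega))
        · exact Or.inr ⟨i, y, by omega, hyz, rfl, Or.inr ⟨by omega, by omega, rfl⟩⟩
      intro n
      induction n with
      | zero => intro y hy _; simp only [Nat.cast_zero, sub_zero] at hy; rw [hy]
      | succ n ih =>
        intro y hy hyz
        push_cast at hy
        exact .head ⟨h.adj i y (by omega) (by omega), hmem y hyz (by omega),
          hmem (y + 1) (by omega) (by omega)⟩ (ih (y + 1) (by omega) (by omega))
    exact key (hi i - z).toNat z (by omega) le_rfl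

theorem LinkSystem.disjoint_absorb (h : LinkSystem G edge R K s t C p lo hi) (lo' hi' : ι → ℤ)
    (a b : U) (v : V) (ha : v ∈ absorb s t C p lo hi lo' hi' a)
    (hb : v ∈ absorb s t C p lo hi lo' hi' b) : a = b := by
  rcases ha with ha | ⟨i, z, hz, hz', rfl, hi₁⟩
  · rcases hb with hb | ⟨j, y, hy, hy', rfl, _⟩
    · exact h.disjoint a b v ha hb
    · exact (h.inner_core j y hy hy' a ha).elim
  · rcases hb with hb | ⟨j, y, hy, hy', he, hj₁⟩
    · exact (h.inner_core i z hz hz' b hb).elim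
    · obtain ⟨rfl, rfl⟩ := h.inner_inj j y i z hy hy' hz hz' he
      rcases hi₁ with ⟨h₁, rfl⟩ | ⟨h₁, h₂, rfl⟩ <;> rcases hj₁ with ⟨h₃, rfl⟩ | ⟨h₃, h₄, rfl⟩ <;>
        first | rfl | omega

theorem LinkSystem.absorb_avoid (h : LinkSystem G edge R K s t C p lo hi) (lo' hi' : ι → ℤ)
    (w : U) : ∀ v ∈ absorb s t C p lo hi lo' hi' w, v ∉ R := by
  rintro v (hv | ⟨i, z, hz, hz', rfl, _⟩)
  · exact h.avoid w v hv
  · exact h.inner_avoid i z hz hz'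

/-- A link system is tight if the ends of its paths lie in the boundary of the territory, and so
does a vertex of each non-empty core. -/
structure Tight (G : SimpleGraph V) (R : Set V) (C : U → Set V) (p : ι → ℤ → V)
    (lo hi : ι → ℤ) : Prop where
  left : ∀ i, lo i ≤ hi i → p i (lo i) ∈ boundary G R
  right : ∀ i, lo i ≤ hi i → p i (hi i) ∈ boundary G R
  core : ∀ w, (C w).Nonempty → ∃ x ∈ C w, x ∈ boundary G R

/-- A link system is made tight by absorbing into the cores the initial and the final segments
of the paths that have no vertex in the boundary, and deleting the cores that do not meet the
boundary. -/
theorem LinkSystem.exists_tight (h : LinkSystem G edge R K s t C p lo hi) :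
    ∃ C' lo' hi', LinkSystem G edge R K s t C' p lo' hi' ∧ Tight G R C' p lo' hi' := by
  classical
  have hex : ∀ i, ∃ a b, (∀ z, lo i ≤ z → z ≤ hi i → p i z ∈ boundary G R → a ≤ z ∧ z ≤ b) ∧
      (b < a ∨ lo i ≤ a ∧ a ≤ b ∧ b ≤ hi i ∧ p i a ∈ boundary G R ∧ p i b ∈ boundary G R) := by
    intro i
    let S : Finset ℤ := (Finset.Icc (lo i) (hi i)).filter fun z => p i z ∈ boundary G R
    have hS : ∀ z, z ∈ S ↔ (lo i ≤ z ∧ z ≤ hi i) ∧ p i z ∈ boundary G R := by simp [S]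
    by_cases hne : S.Nonempty
    · have h₁ := (hS _).1 (S.min'_mem hne)
      have h₂ := (hS _).1 (S.max'_mem hne)
      exact ⟨S.min' hne, S.max' hne,
        fun z hz hz' hb => ⟨S.min'_le z ((hS z).2 ⟨⟨hz, hz'⟩, hb⟩),
          S.le_max' z ((hS z).2 ⟨⟨hz, hz'⟩, hb⟩)⟩,
        Or.inr ⟨h₁.1.1, S.min'_le_max' hne, h₂.1.2, h₁.2, h₂.2⟩⟩
    · refine ⟨1, 0, fun z hz hz' hb => (hne ⟨z, (hS z).2 ⟨⟨hz, hz'⟩, hb⟩⟩).elim,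
        Or.inl one_pos⟩
  choose lo' hi' hall hlh using hex
  have hv : ∀ i, lo' i ≤ hi' i → lo i ≤ lo' i ∧ hi' i ≤ hi i ∧ p i (lo' i) ∈ boundary G R ∧
      p i (hi' i) ∈ boundary G R := by
    intro i hi₁
    rcases hlh i with h₁ | ⟨h₁, -, h₂, h₃, h₄⟩
    · omega
    · exact ⟨h₁, h₂, h₃, h₄⟩
  refine ⟨fun w => {v | v ∈ absorb s t C p lo hi lo' hi' w ∧
    ∃ x ∈ absorb s t C p lo hi lo' hi' w, x ∈ boundary G R}, lo', hi', ?_, ?_⟩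
  · have hmem : ∀ {v w}, v ∈ absorb s t C p lo hi lo' hi' w → v ∈ boundary G R →
        v ∈ {v | v ∈ absorb s t C p lo hi lo' hi' w ∧
          ∃ x ∈ absorb s t C p lo hi lo' hi' w, x ∈ boundary G R} :=
      fun {v w} h₁ h₂ => ⟨h₁, v, h₁, h₂⟩
    refine ⟨h.ends, ?_, ?_, ?_, ?_, ?_, ?_, ?_, ?_, ?_, ?_, ?_, ?_⟩
    · intro w
      by_cases hw : ∃ x ∈ absorb s t C p lo hi lo' hi' w, x ∈ boundary G R
      · simpa only [hw, and_true, Set.ofPred_mem_eq] using h.linked_absorb lo' hi' w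
      · exact fun a ha => (hw ha.2).elim
    · exact fun a b v ha hb => h.disjoint_absorb lo' hi' a b v ha.1 hb.1
    · exact fun w v hv' => h.absorb_avoid lo' hi' w v hv'.1
    · intro i hi₁
      obtain ⟨h₁, h₂, h₃, -⟩ := hv i hi₁.le
      refine hmem ?_ h₃
      rcases h₁.eq_or_lt with h₁ | h₁
      · exact Or.inl (h₁ ▸ h.left i (by omega))
      · exact Or.inr ⟨i, _, h₁, by omega, rfl, Or.inl ⟨le_rfl, rfl⟩⟩
    · intro i hi₁
      obtain ⟨h₁, h₂, -, h₃⟩ := hv i hi₁.le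
      refine hmem ?_ h₃
      rcases h₂.eq_or_lt with h₂ | h₂
      · exact Or.inl (h₂ ▸ h.right i (by omega))
      · exact Or.inr ⟨i, _, by omega, h₂, rfl, Or.inr ⟨hi₁, le_rfl, rfl⟩⟩
    · intro i hi₁
      obtain ⟨h₁, h₂, h₃, -⟩ := hv i hi₁.le
      rcases h₁.eq_or_lt with h₁ | h₁
      · by_cases hlt : lo i < hi i
        · exact Or.inl (hmem (Or.inl (h₁ ▸ h.left i hlt)) h₃)
        · exact (h.single i (by omega)).imp (fun h' => hmem (Or.inl (h₁ ▸ h')) h₃)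
            fun h' => hmem (Or.inl (h₁ ▸ h')) h₃
      · by_cases hlt : lo' i < hi i
        · exact Or.inl (hmem (Or.inr ⟨i, _, h₁, hlt, rfl, Or.inl ⟨le_rfl, rfl⟩⟩) h₃)
        · have he : lo' i = hi i := by omega
          exact Or.inr (hmem (Or.inl (he ▸ h.right i (by omega))) h₃)
    · intro i z h₁ h₂
      obtain ⟨h₃, h₄, -⟩ := hv i (by omega)
      exact h.adj i z (by omega) (by omega)
    · rintro i z h₁ h₂ w ⟨hw | ⟨j, y, hy, hy', he, hj⟩, -⟩ <;>
        obtain ⟨h₃, h₄, -⟩ := hv i (by omega)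
      · exact h.inner_core i z (by omega) (by omega) w hw
      · obtain ⟨rfl, rfl⟩ := h.inner_inj j y i z hy hy' (by omega) (by omega) he
        rcases hj with ⟨h₅, -⟩ | ⟨-, h₅, -⟩ <;> omega
    · intro i z h₁ h₂
      obtain ⟨h₃, h₄, -⟩ := hv i (by omega)
      exact h.inner_avoid i z (by omega) (by omega)
    · intro i z j y h₁ h₂ h₃ h₄
      obtain ⟨h₅, h₆, -⟩ := hv i (by omega)
      obtain ⟨h₇, h₈, -⟩ := hv j (by omega)
      exact h.inner_inj i z j y (by omega) (by omega) (by omega) (by omega)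
    · intro v hb
      obtain ⟨i, z, h₁, h₂, rfl⟩ := h.cover v hb
      obtain ⟨h₃, h₄⟩ := hall i z h₁ h₂ hb
      exact ⟨i, z, h₃, h₄, rfl⟩
    · intro i z h₁ h₂
      obtain ⟨h₃, h₄, -⟩ := hv i (by omega)
      exact h.guarded i z (by omega) (by omega)
  · exact ⟨fun i hi₁ => (hv i hi₁).2.2.1, fun i hi₁ => (hv i hi₁).2.2.2,
      fun w ⟨v, hv'⟩ => ⟨hv'.2.choose, ⟨hv'.2.choose_spec.1, hv'.2⟩, hv'.2.choose_spec.2⟩⟩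

/-- If every edge carries a path, the cores, enlarged by the inner vertices of these paths, are the
branch sets of a minor model in which all of them are next to `R`. -/
theorem LinkSystem.exists_model (h : LinkSystem G edge R K s t C p lo hi)
    (ht : Tight G R C p lo hi) (hall : ∀ i, lo i < hi i) (hU : ∀ w, ∃ i, w ∈ edge i) :
    HasModelAround G edge R := by
  refine ⟨absorb s t C p lo hi hi hi, h.linked_absorb hi hi, h.disjoint_absorb hi hi,
    h.absorb_avoid hi hi, fun w => ?_, fun i a b he => ?_⟩
  · obtain ⟨i, hi₁⟩ := hU w
    have hne : (C w).Nonempty := by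
      rw [← h.ends i, Sym2.mem_iff] at hi₁
      rcases hi₁ with rfl | rfl
      · exact ⟨_, h.left i (hall i)⟩
      · exact ⟨_, h.right i (hall i)⟩
    obtain ⟨x, hx, -, r, hr, hrx⟩ := ht.core w hne
    exact ⟨x, Or.inl hx, r, hr, hrx⟩
  · have hlt := hall i
    have hx : p i (hi i - 1) ∈ absorb s t C p lo hi hi hi (s i) := by
      rcases (show lo i ≤ hi i - 1 by omega).eq_or_lt with h₁ | h₁
      · exact Or.inl (h₁ ▸ h.left i hlt)
      · exact Or.inr ⟨i, _, h₁, by omega, rfl, Or.inl ⟨by omega, rfl⟩⟩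
    have hy : p i (hi i) ∈ absorb s t C p lo hi hi hi (t i) := Or.inl (h.right i hlt)
    have hadj := h.adj i (hi i - 1) (by omega) (by omega)
    rw [sub_add_cancel] at hadj
    rw [← h.ends i, Sym2.eq_iff] at he
    rcases he with ⟨rfl, rfl⟩ | ⟨rfl, rfl⟩
    · exact ⟨_, hx, _, hy, hadj⟩
    · exact ⟨_, hy, _, hx, hadj.symm⟩

open Classical in
/-- An edge `i` that carries no vertex but possibly `x` can be given a path from the core of one of
its ends to the core of the other through the territory. If the first core is empty, it becomes
`{x}`, and the path consists of `x` alone; if the second one is empty, it becomes `{y}`. -/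
theorem LinkSystem.extend (h : LinkSystem G edge R K s t C p lo hi) {i : ι} {u v : U} {x y : V}
    (huv : s(u, v) = edge i) (hne : u ≠ v) (hlohi : hi i ≤ lo i)
    (hlo : lo i = hi i → p i (lo i) = x)
    (hx : x ∈ C u ∨ C u = ∅ ∧ x = y) (hy : y ∈ R) (hyv : C v = ∅ ∨ ∃ c ∈ C v, G.Adj y c)
    {q : ℤ → V} {k : ℤ} (hk : 0 ≤ k) (hq0 : q 0 = x) (hqk : q k = y)
    (hqR : ∀ z, 0 < z → z ≤ k → q z ∈ R) (hqadj : ∀ z, 0 ≤ z → z < k → G.Adj (q z) (q (z + 1)))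
    (hqinj : ∀ z z', 0 ≤ z → z ≤ k → 0 ≤ z' → z' ≤ k → q z = q z' → z = z')
    {R' : Set V} (hR : R' ⊆ R) (hRq : ∀ v ∈ R', v ∉ q '' Set.Icc 0 k)
    (hclosed : ∀ a ∈ R', ∀ b ∈ R, G.Adj a b → b ∈ R' ∨ b ∈ q '' Set.Icc 0 k) :
    LinkSystem G edge R' (Function.update K i (q '' Set.Icc 0 k)) (Function.update s i u)
      (Function.update t i v)
      (fun w => {a | a ∈ C w ∨ w = u ∧ a = x ∨ w = v ∧ a = y ∧ x ≠ y})
      (Function.update p i q) (Function.update lo i 0) (Function.update hi i k) := by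
  have hxy : 0 < k → x ∉ R ∧ x ∈ C u ∧ x ≠ y := by
    intro hk0
    have hxy : x ≠ y := by
      intro he
      have := hqinj 0 k le_rfl hk hk le_rfl (by rw [hq0, hqk, he])
      omega
    rcases hx with hx | ⟨-, hx⟩
    · exact ⟨h.avoid u x hx, hx, hxy⟩
    · exact (hxy hx).elim
  have hyP : y ∈ q '' Set.Icc 0 k := ⟨k, ⟨hk, le_rfl⟩, hqk⟩
  have hxP : x ∈ q '' Set.Icc 0 k := ⟨0, ⟨le_rfl, hk⟩, hq0⟩
  have hyC : ∀ w, y ∉ C w := fun w hw => h.avoid w y hw hy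
  have hxu : ∀ w, x ∈ C w → w = u := by
    intro w hw
    rcases hx with hx | ⟨-, rfl⟩
    · exact h.disjoint w u x hw hx
    · exact (hyC w hw).elim
  have hinner : ∀ j z, j ≠ i → lo j < z → z < hi j → p j z ≠ x ∧ p j z ≠ y := by
    intro j z _ h₁ h₂
    have h₃ := h.inner_avoid j z h₁ h₂
    have h₄ := h.inner_core j z h₁ h₂
    refine ⟨fun he => ?_, fun he => h₃ (he ▸ hy)⟩
    rcases hx with hx | ⟨-, hx⟩
    · exact h₄ u (he ▸ hx)
    · exact h₃ (he ▸ hx ▸ hy)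
  refine ⟨?_, ?_, ?_, ?_, ?_, ?_, ?_, ?_, ?_, ?_, ?_, ?_, ?_⟩
  · intro j
    rcases eq_or_ne j i with rfl | hj
    · simpa using huv
    · simpa [hj] using h.ends j
  · intro w
    rcases eq_or_ne w u with rfl | hwu
    · rcases hx with hx | ⟨hx, hx'⟩
      · convert h.linked w using 1
        ext a
        simp only [hne, true_and, false_and, or_false, Set.mem_ofPred_eq]
        exact ⟨fun ha => ha.elim id fun ha => ha ▸ hx, Or.inl⟩
      · convert linked_singleton (G := G) x using 1
        ext a
        simp [hx, hne]
    · by_cases hwv : w = v ∧ x ≠ y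
      · obtain ⟨rfl, hxy'⟩ := hwv
        rcases hyv with hyv | ⟨c, hc, hyc⟩
        · convert linked_singleton (G := G) y using 1
          ext a
          simp [hyv, hwu, hxy']
        · convert (h.linked w).insert hc hyc using 1
          ext a
          simp [hwu, hxy', or_comm]
      · convert h.linked w using 1
        ext a
        simp only [Set.mem_ofPred_eq, hwu, false_and, false_or]
        exact ⟨fun ha => ha.elim id fun ha => (hwv ⟨ha.1, ha.2.2⟩).elim, Or.inl⟩
  · rintro a b v' (ha | ⟨rfl, rfl⟩ | ⟨rfl, rfl, ha⟩) (hb | ⟨rfl, hb⟩ | ⟨rfl, hb, hb'⟩)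
    · exact h.disjoint a b v' ha hb
    · exact hxu a (hb ▸ ha)
    · exact (hyC a (hb ▸ ha)).elim
    · exact (hxu b hb).symm
    · rfl
    · exact (hb' hb).elim
    · exact (hyC b hb).elim
    · exact (ha hb.symm).elim
    · rfl
  · rintro w a (ha | ⟨-, rfl⟩ | ⟨-, rfl, -⟩) haR
    · exact h.avoid w a ha (hR haR)
    · exact hRq _ haR hxP
    · exact hRq _ haR hyP
  · intro j hj₁
    rcases eq_or_ne j i with rfl | hj
    · simp only [Function.update_self]
      exact Or.inr (Or.inl ⟨trivial, hq0⟩)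
    · simp only [Function.update_of_ne hj] at hj₁ ⊢
      exact Or.inl (h.left j hj₁)
  · intro j hj₁
    rcases eq_or_ne j i with rfl | hj
    · simp only [Function.update_self] at hj₁ ⊢
      exact Or.inr (Or.inr ⟨trivial, hqk, (hxy hj₁).2.2⟩)
    · simp only [Function.update_of_ne hj] at hj₁ ⊢
      exact Or.inl (h.right j hj₁)
  · intro j hj₁
    rcases eq_or_ne j i with rfl | hj
    · simp only [Function.update_self]
      exact Or.inl (Or.inr (Or.inl ⟨trivial, hq0⟩))
    · simp only [Function.update_of_ne hj] at hj₁ ⊢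
      exact (h.single j hj₁).imp Or.inl Or.inl
  · intro j z h₁ h₂
    rcases eq_or_ne j i with rfl | hj
    · simp only [Function.update_self] at h₁ h₂ ⊢
      exact hqadj z h₁ h₂
    · simp only [Function.update_of_ne hj] at h₁ h₂ ⊢
      exact h.adj j z h₁ h₂
  · intro j z h₁ h₂ w
    rcases eq_or_ne j i with rfl | hj
    · simp only [Function.update_self] at h₁ h₂ ⊢
      have hzR := hqR z h₁ h₂.le
      rintro (hw | ⟨-, hw⟩ | ⟨-, hw, -⟩)
      · exact h.avoid w _ hw hzR
      · exact (hxy (by omega)).1 (hw ▸ hzR)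
      · have := hqinj z k h₁.le h₂.le hk le_rfl (by rw [hw, hqk])
        omega
    · simp only [Function.update_of_ne hj] at h₁ h₂ ⊢
      rintro (hw | ⟨-, hw⟩ | ⟨-, hw, -⟩)
      · exact h.inner_core j z h₁ h₂ w hw
      · exact (hinner j z hj h₁ h₂).1 hw
      · exact (hinner j z hj h₁ h₂).2 hw
  · intro j z h₁ h₂ hzR
    rcases eq_or_ne j i with rfl | hj
    · simp only [Function.update_self] at h₁ h₂ hzR
      exact hRq _ hzR ⟨z, ⟨h₁.le, h₂.le⟩, rfl⟩
    · simp only [Function.update_of_ne hj] at h₁ h₂ hzR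
      exact h.inner_avoid j z h₁ h₂ (hR hzR)
  · intro j z j' z' h₁ h₂ h₃ h₄ he
    by_cases hj : j = i <;> by_cases hj' : j' = i
    · subst hj hj'
      simp only [Function.update_self] at h₁ h₂ h₃ h₄ he
      exact ⟨rfl, hqinj z z' h₁.le h₂.le h₃.le h₄.le he⟩
    · subst hj
      simp only [Function.update_self, Function.update_of_ne hj'] at h₁ h₂ h₃ h₄ he
      exact (h.inner_avoid j' z' h₃ h₄ (he ▸ hqR z h₁ h₂.le)).elim
    · subst hj'
      simp only [Function.update_self, Function.update_of_ne hj] at h₁ h₂ h₃ h₄ he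
      exact (h.inner_avoid j z h₁ h₂ (he ▸ hqR z' h₃ h₄.le)).elim
    · simp only [Function.update_of_ne hj, Function.update_of_ne hj'] at h₁ h₂ h₃ h₄ he
      exact h.inner_inj j z j' z' h₁ h₂ h₃ h₄ he
  · rintro b ⟨hb, r, hr, hrb⟩
    have hP : b ∈ q '' Set.Icc 0 k → ∃ j z, Function.update lo i 0 j ≤ z ∧
        z ≤ Function.update hi i k j ∧ Function.update p i q j z = b := by
      rintro ⟨z, ⟨h₁, h₂⟩, rfl⟩
      exact ⟨i, z, by simpa using h₁, by simpa using h₂, by simp⟩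
    by_cases hbR : b ∈ R
    · exact hP ((hclosed r hr b hbR hrb).resolve_left hb)
    · obtain ⟨j, z, h₁, h₂, rfl⟩ := h.cover b ⟨hbR, r, hR hr, hrb⟩
      rcases eq_or_ne j i with rfl | hj
      · obtain rfl : z = lo j := by omega
        rw [hlo (by omega)] at hP ⊢
        exact hP hxP
      · exact ⟨j, z, by simpa [hj] using h₁, by simpa [hj] using h₂, by simp [hj]⟩
  · intro j z h₁ h₂
    rcases eq_or_ne j i with rfl | hj
    · simp only [Function.update_self] at h₁ h₂ ⊢
      exact ⟨z, ⟨h₁, h₂⟩, rfl⟩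
    · simp only [Function.update_of_ne hj] at h₁ h₂ ⊢
      exact h.guarded j z h₁ h₂

end LinkSystem

/-- The groups guarding the sets `K i` confine the robber to the territory `R`, and the boundary of
`R` carries a tight partial minor model. -/
def Confined {V ι U : Type*} (G : SimpleGraph V) (edge : ι → Sym2 U) (R : Set V)
    (K : ι → Set V) : Prop :=
  ∃ (s t : ι → U) (C : U → Set V) (p : ι → ℤ → V) (lo hi : ι → ℤ),
    LinkSystem G edge R K s t C p lo hi ∧ Tight G R C p lo hi

theorem Confined.cover {V ι U : Type*} {G : SimpleGraph V} {edge : ι → Sym2 U} {R : Set V}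
    {K : ι → Set V} (h : Confined G edge R K) {v : V} (hv : v ∈ boundary G R) :
    ∃ i, v ∈ K i := by
  obtain ⟨s, t, C, p, lo, hi, h, -⟩ := h
  obtain ⟨i, z, h₁, h₂, rfl⟩ := h.cover v hv
  exact ⟨i, h.guarded i z h₁ h₂⟩

theorem confined_univ {V ι U : Type*} [Nonempty V] (G : SimpleGraph V) (edge : ι → Sym2 U)
    (K : ι → Set V) : Confined G edge Set.univ K := by
  have hend : ∀ i, ∃ a b : U, s(a, b) = edge i := by
    intro i
    induction edge i with
    | _ a b => exact ⟨a, b, rfl⟩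
  choose s t hst using hend
  refine ⟨s, t, fun _ => ∅, fun _ _ => Classical.arbitrary V, fun _ => 1, fun _ => 0, ?_, ?_⟩
  · refine ⟨hst, ?_, ?_, ?_, ?_, ?_, ?_, ?_, ?_, ?_, ?_, ?_, ?_⟩
    · rintro w a ⟨⟩
    · rintro a b v ⟨⟩
    · rintro w v ⟨⟩
    · intro i hi; omega
    · intro i hi; omega
    · intro i hi; omega
    · intro i z h₁ h₂; omega
    · intro i z h₁ h₂; omega
    · intro i z h₁ h₂; omega
    · intro i z j y h₁ h₂; omega
    · rintro v ⟨hv, -⟩; exact (hv trivial).elim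
    · intro i z h₁ h₂; omega
  · exact ⟨fun i hi => by omega, fun i hi => by omega, by rintro w ⟨v, ⟨⟩⟩⟩

open Classical in
/-- Unless there is a minor, some group `i` guards at most one vertex `x` that is not guarded by
the others; and if it guards a suitable path from `x` through the territory instead, this divides
the territory into smaller ones of the same kind. -/
theorem Confined.exists_extension {V ι U : Type*} {G : SimpleGraph V} {edge : ι → Sym2 U}
    {R : Set V} {K : ι → Set V} (h : Confined G edge R K) (hR : R.Nonempty)
    (hedge : ∀ i, ¬ (edge i).IsDiag) (hU : ∀ w, ∃ i, w ∈ edge i)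
    (hmin : ¬ HasModelAround G edge R) :
    ∃ i x y, y ∈ R ∧ (x = y ∨ x ∈ boundary G R) ∧
      (∀ v ∈ boundary G R, v = x ∨ ∃ j, j ≠ i ∧ v ∈ K j) ∧
      ∀ (q : ℤ → V) (k : ℤ), 0 ≤ k → q 0 = x → q k = y → (∀ z, 0 < z → z ≤ k → q z ∈ R) →
        (∀ z, 0 ≤ z → z < k → G.Adj (q z) (q (z + 1))) →
        (∀ z z', 0 ≤ z → z ≤ k → 0 ≤ z' → z' ≤ k → q z = q z' → z = z') →
        ∀ R' ⊆ R, (∀ v ∈ R', v ∉ q '' Set.Icc 0 k) →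
        (∀ a ∈ R', ∀ b ∈ R, G.Adj a b → b ∈ R' ∨ b ∈ q '' Set.Icc 0 k) →
        Confined G edge R' (Function.update K i (q '' Set.Icc 0 k)) := by
  obtain ⟨s, t, C, p, lo, hi, h, ht⟩ := h
  obtain ⟨i, hi₁⟩ : ∃ i, hi i ≤ lo i := by
    by_contra! hall
    exact hmin (h.exists_model ht hall hU)
  -- The start of the path lies in the core of an end `u` of the edge, unless both cores are empty.
  obtain ⟨u, v, x, huv, hlo, hx⟩ : ∃ u v x, s(u, v) = edge i ∧ (lo i = hi i → p i (lo i) = x) ∧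
      (x ∈ C u ∧ x ∈ boundary G R ∨ C u = ∅ ∧ C v = ∅ ∧ x ∈ R) := by
    have hswap : s(t i, s i) = edge i := by rw [Sym2.eq_swap]; exact h.ends i
    by_cases he : lo i = hi i
    · have hb := ht.left i he.le
      rcases h.single i he with hx | hx
      · exact ⟨s i, t i, _, h.ends i, fun _ => rfl, Or.inl ⟨hx, hb⟩⟩
      · exact ⟨t i, s i, _, hswap, fun _ => rfl, Or.inl ⟨hx, hb⟩⟩
    · rcases (C (s i)).eq_empty_or_nonempty with hs | hs
      · rcases (C (t i)).eq_empty_or_nonempty with ht' | ht'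
        · obtain ⟨y, hy⟩ := hR
          exact ⟨s i, t i, y, h.ends i, fun h' => (he h').elim, Or.inr ⟨hs, ht', hy⟩⟩
        · obtain ⟨x, hx, hb⟩ := ht.core _ ht'
          exact ⟨t i, s i, x, hswap, fun h' => (he h').elim, Or.inl ⟨hx, hb⟩⟩
      · obtain ⟨x, hx, hb⟩ := ht.core _ hs
        exact ⟨s i, t i, x, h.ends i, fun h' => (he h').elim, Or.inl ⟨hx, hb⟩⟩
  have hne : u ≠ v := by
    intro he
    exact hedge i (by rw [← huv, he]; exact Sym2.mk_isDiag_iff.2 rfl)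
  obtain ⟨y, hy, hyv, hxy⟩ : ∃ y ∈ R, (C v = ∅ ∨ ∃ c ∈ C v, G.Adj y c) ∧
      (x ∈ C u ∧ x ∈ boundary G R ∨ C u = ∅ ∧ x = y) := by
    rcases hx with hx | ⟨hu, hv, hxR⟩
    · rcases (C v).eq_empty_or_nonempty with hv | hv
      · obtain ⟨y, hy⟩ := hR
        exact ⟨y, hy, Or.inl hv, Or.inl hx⟩
      · obtain ⟨c, hc, -, y, hy, hyc⟩ := ht.core _ hv
        exact ⟨y, hy, Or.inr ⟨c, hc, hyc⟩, Or.inl hx⟩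
    · exact ⟨x, hxR, Or.inl hv, Or.inr ⟨hu, rfl⟩⟩
  refine ⟨i, x, y, hy, hxy.symm.imp And.right And.right, fun b hb => ?_, ?_⟩
  · obtain ⟨j, z, h₁, h₂, rfl⟩ := h.cover b hb
    rcases eq_or_ne j i with rfl | hj
    · obtain rfl : z = lo j := by omega
      exact Or.inl (hlo (by omega))
    · exact Or.inr ⟨j, hj, h.guarded j z h₁ h₂⟩
  · intro q k hk hq0 hqk hqR hqadj hqinj R' hR' hRq hclosed
    obtain ⟨C', lo', hi', h', ht'⟩ := (h.extend huv hne hi₁ hlo (hxy.imp And.left id) hy hyv hk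
      hq0 hqk hqR hqadj hqinj hR' hRq hclosed).exists_tight
    exact ⟨_, _, C', _, lo', hi', h', ht'⟩

/-! ### Geodesics through the territory -/

/-- The offsets `off` suit `G` if the distances to a fixed vertex of the ends of an edge, in any
connected induced subgraph, always differ by one of them. -/
def Suits {V J : Type*} (G : SimpleGraph V) (off : J → ℤ) : Prop :=
  ∀ (S : Set V) (a u v : S), (G.induce S).Connected → (G.induce S).Adj u v →
    ∃ l, off l = ((G.induce S).dist a v : ℤ) - (G.induce S).dist a u

theorem suits_three {V : Type*} (G : SimpleGraph V) : Suits G fun l : Fin 3 => (l : ℤ) - 1 := by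
  intro S a u v hS huv
  have h₁ := hS.dist_triangle (u := a) (v := u) (w := v)
  have h₂ := hS.dist_triangle (u := a) (v := v) (w := u)
  have h₃ := SimpleGraph.dist_eq_one_iff_adj.2 huv
  have h₄ := SimpleGraph.dist_eq_one_iff_adj.2 huv.symm
  have h₅ : ((G.induce S).dist a v : ℤ) - (G.induce S).dist a u + 1 < 3 := by omega
  refine ⟨⟨(((G.induce S).dist a v : ℤ) - (G.induce S).dist a u + 1).toNat, by omega⟩, ?_⟩
  simp only
  omega

/-- In a bipartite graph the distances to a fixed vertex of the ends of an edge differ by exactly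
one. -/
theorem suits_two {V : Type*} {G : SimpleGraph V} (hG : G.IsBipartite) :
    Suits G fun l : Fin 2 => 2 * (l : ℤ) - 1 := by
  intro S a u v hS huv
  have h₁ := hS.dist_triangle (u := a) (v := u) (w := v)
  have h₂ := hS.dist_triangle (u := a) (v := v) (w := u)
  have h₃ := SimpleGraph.dist_eq_one_iff_adj.2 huv
  have h₄ := SimpleGraph.dist_eq_one_iff_adj.2 huv.symm
  have hne : (G.induce S).dist a u ≠ (G.induce S).dist a v := by
    intro he
    obtain ⟨c⟩ := hG
    let c' : (G.induce S).Coloring Bool :=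
      SimpleGraph.Coloring.mk (fun w => decide (c w.1 = 0)) fun {x y} hxy => by
        have hc : c x.1 ≠ c y.1 := c.valid hxy
        intro h
        have h' := decide_eq_decide.1 h
        omega
    obtain ⟨w₁, hw₁⟩ := hS.exists_walk_length_eq_dist a u
    obtain ⟨w₂, hw₂⟩ := hS.exists_walk_length_eq_dist a v
    have e₁ := c'.even_length_iff_congr w₁
    have e₂ := c'.even_length_iff_congr w₂
    rw [hw₁] at e₁
    rw [hw₂, ← he] at e₂
    have hv := c'.valid huv
    have e := e₁.symm.trans e₂
    revert e hv
    cases c' a <;> cases c' u <;> cases c' v <;> simp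
  have h₅ : ((G.induce S).dist a v : ℤ) = (G.induce S).dist a u + 1 ∨
      ((G.induce S).dist a v : ℤ) = (G.induce S).dist a u - 1 := by omega
  rcases h₅ with h₅ | h₅
  · exact ⟨1, by simp [h₅]⟩
  · exact ⟨0, by simp [h₅]⟩

/-- The distance to `x` in the graph induced on the territory and `x` is a projection to a shortest
path from `x` to `y` in that graph. -/
theorem exists_geodesic {V J : Type*} {G : SimpleGraph V} {off : J → ℤ} (hs : Suits G off)
    (hoff : ∀ l, |off l| ≤ 1) {R : Set V} (hR : Linked G R) {x y : V} (hy : y ∈ R)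
    (hx : x = y ∨ x ∈ boundary G R) :
    ∃ (q : ℤ → V) (k : ℤ) (d : V → ℤ), q 0 = x ∧ q k = y ∧ (∀ z, 0 < z → z ≤ k → q z ∈ R) ∧
      (∀ z, 0 ≤ z → z ≤ k → d (q z) = z) ∧ (∀ u ∈ R, 0 ≤ d u) ∧ (∀ u ∈ R, d u = 0 → u = x) ∧
      PathGuard G off R (q '' Set.Icc 0 k) q k d := by
  classical
  have hS : (G.induce (insert x R)).Connected := by
    refine Linked.connected ?_ ⟨x, Or.inl rfl⟩
    rcases hx with rfl | ⟨-, r, hr, hrx⟩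
    · rwa [Set.insert_eq_of_mem hy]
    · exact hR.insert hr hrx.symm
  let a : (insert x R : Set V) := ⟨x, Or.inl rfl⟩
  let b : (insert x R : Set V) := ⟨y, Or.inr hy⟩
  let d : V → ℤ := fun v =>
    if hv : v ∈ insert x R then ((G.induce (insert x R)).dist a ⟨v, hv⟩ : ℤ) else 0
  have hd : ∀ v : (insert x R : Set V), d v.1 = (G.induce (insert x R)).dist a v := by
    rintro ⟨v, hv⟩
    simp only [d, dif_pos hv]
  obtain ⟨w, hw⟩ := hS.exists_walk_length_eq_dist a b
  let q : ℤ → V := fun z => (w.getVert z.toNat).1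
  have hdq : ∀ z : ℤ, 0 ≤ z → z ≤ w.length → d (q z) = z := by
    intro z hz hzw
    have h₁ := SimpleGraph.dist_le (w.take z.toNat)
    have h₂ := SimpleGraph.dist_le (w.drop z.toNat)
    have h₃ := hS.dist_triangle (u := a) (v := w.getVert z.toNat) (w := b)
    rw [SimpleGraph.Walk.take_length] at h₁
    rw [SimpleGraph.Walk.drop_length] at h₂
    have h₄ := hd (w.getVert z.toNat)
    simp only [q]
    omega
  have hq0 : q 0 = x := by simp [q, a]
  have hlip : ∀ u ∈ R, ∀ v : (insert x R : Set V), G.Adj u v.1 → ∃ l, off l = d v.1 - d u := by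
    intro u hu v huv
    obtain ⟨l, hl⟩ := hs _ a ⟨u, Or.inr hu⟩ v hS huv
    exact ⟨l, by rw [hl, hd v, hd ⟨u, Or.inr hu⟩]⟩
  refine ⟨q, w.length, d, hq0, by simp [q, b], fun z hz hzw => ?_, hdq, fun u hu => ?_,
    fun u hu h0 => ?_, Int.natCast_nonneg _, fun z hz hzw => ?_, fun u hu v hv huv => ?_, ?_, ?_⟩
  · rcases (w.getVert z.toNat).2 with h | h
    · have h₁ := hdq z hz.le hzw
      have h₂ := hdq 0 le_rfl (by omega)
      rw [hq0, ← h] at h₂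
      simp only [q] at h₁
      omega
    · exact h
  · rw [hd ⟨u, Or.inr hu⟩]
    exact Int.natCast_nonneg _
  · rw [hd ⟨u, Or.inr hu⟩] at h0
    have := (hS.dist_eq_zero_iff).1 (Int.natCast_eq_zero.1 h0)
    exact (congrArg Subtype.val this).symm
  · have h₁ := w.adj_getVert_succ (i := z.toNat) (by omega)
    have h₂ : (z + 1).toNat = z.toNat + 1 := by omega
    simp only [q, h₂]
    exact h₁
  · obtain ⟨l, hl⟩ := hlip u hu ⟨v, Or.inr hv⟩ huv
    rw [abs_sub_comm, ← hl]
    exact hoff l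
  · rintro v ⟨z, ⟨h₁, h₂⟩, rfl⟩
    exact ⟨z, h₁, h₂, rfl⟩
  · intro u hu z hz hzw _ huv
    obtain ⟨l, hl⟩ := hlip u hu (w.getVert z.toNat) huv
    exact ⟨l, by rw [hl]; have := hdq z hz hzw; simp only [q] at this; omega⟩

/-! ### Shrinking the territory -/

theorem linked_component {V : Type*} (G : SimpleGraph V) (A : Set V) (r : V) :
    Linked G {v | Relation.ReflTransGen (fun x y => G.Adj x y ∧ x ∈ A ∧ y ∈ A) r v} := by
  refine (linked_singleton r).of_anchored (Set.singleton_subset_iff.2 .refl) fun v hv =>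
    ⟨r, rfl, reflTransGen_adj_symm ?_⟩
  induction (show Relation.ReflTransGen (fun x y => G.Adj x y ∧ x ∈ A ∧ y ∈ A) r v from hv) with
  | refl => exact .refl
  | tail h h' ih => exact (ih h).tail ⟨h'.1, h, h.tail h'⟩

/-- With one group of cops for each edge, the cops win against a robber confined to a territory
around which there is no minor model: they can always redeploy one group so as to confine him to a
smaller territory. -/
theorem wins_of_confined {V ι J U : Type*} [Finite V] [Finite J] {G : SimpleGraph V}
    (hG : G.Connected) {off : J → ℤ} (hs : Suits G off) (hoff : ∀ l, |off l| ≤ 1)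
    (hone : ∃ l, off l = 1) {edge : ι → Sym2 U} (hedge : ∀ i, ¬ (edge i).IsDiag)
    (hU : ∀ w, ∃ i, w ∈ edge i)
    (hmin : ∀ R : Set V, R.Nonempty → Linked G R → ¬ HasModelAround G edge R) (n : ℕ) :
    ∀ (R : Set V) (K : ι → Set V) (g : ι → V → J → V), R.ncard ≤ n → Linked G R →
      Confined G edge R K →
      (∀ j, ∃ p k d, PathGuard G off R (K j) p k d ∧ g j = shadow off p k d) →
      ∀ r ∈ R, Wins G (fun q : ι × J => g q.1 r q.2) r := by
  classical
  induction n with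
  | zero =>
    intro R K g hn _ _ _ r hr
    have := (Set.ncard_pos (Set.toFinite R)).2 ⟨r, hr⟩
    omega
  | succ n ih =>
    intro R K g hn hR hK hg r hr
    obtain ⟨i, x, y, hy, hxy, hxK, hext⟩ :=
      hK.exists_extension ⟨r, hr⟩ hedge hU (hmin R ⟨r, hr⟩ hR)
    obtain ⟨q, k, d, hq0, hqk, hqR, hdq, hd, hd0, hq⟩ := exists_geodesic hs hoff hR hy hxy
    -- Whether `x` is guarded by group `i` alone.
    let esc : Prop := x ∈ boundary G R ∧ ∀ j, j ≠ i → x ∉ K j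
    have ho : Others G R K g i x esc := by
      refine ⟨fun j _ u hu v hv huv l => ?_, fun j _ u hu v hv huv => ?_,
        fun u hu v hv huv => ?_⟩
      · obtain ⟨p, k, d, hp, he⟩ := hg j
        rw [he]
        exact hp.step_shadow hu hv huv l
      · obtain ⟨p, k, d, hp, he⟩ := hg j
        rw [he]
        exact hp.exists_shadow_eq hu hv huv
      · by_cases hj : ∃ j, j ≠ i ∧ v ∈ K j
        · exact Or.inl hj
        · have hb : v ∈ boundary G R := ⟨hv, u, hu, huv⟩
          obtain rfl := (hxK v hb).resolve_right hj
          exact Or.inr ⟨⟨hb, fun j hj' hv' => hj ⟨j, hj', hv'⟩⟩, rfl⟩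
    have hnew : ∀ r ∈ R, r ∉ q '' Set.Icc 0 k →
        Wins G (deploy g i (shadow off q k d r) r) r := by
      intro r hr hrq
      let R' : Set V := {v | Relation.ReflTransGen
        (fun x y => G.Adj x y ∧ x ∈ R \ q '' Set.Icc 0 k ∧ y ∈ R \ q '' Set.Icc 0 k) r v}
      have hR' : R' ⊆ R \ q '' Set.Icc 0 k := by
        intro v hv
        rcases Relation.ReflTransGen.cases_tail hv with rfl | ⟨_, -, h⟩
        · exact ⟨hr, hrq⟩
        · exact h.2.2
      have hsub : R' ⊆ R := fun v hv => (hR' hv).1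
      have hlt : R'.ncard < R.ncard := by
        refine Set.ncard_lt_ncard ⟨hsub, fun h => (hR' (h hy)).2 ?_⟩ (Set.toFinite R)
        exact ⟨k, ⟨hq.nonneg, le_rfl⟩, hqk⟩
      have hK' : Confined G edge R' (Function.update K i (q '' Set.Icc 0 k)) := by
        refine hext q k hq.nonneg hq0 hqk hqR hq.adj (fun z z' h₁ h₂ h₃ h₄ he => ?_) R' hsub
          (fun v hv => (hR' hv).2) fun a ha b hb hab => ?_
        · rw [← hdq z h₁ h₂, he, hdq z' h₃ h₄]
        · by_cases hbq : b ∈ q '' Set.Icc 0 k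
          · exact Or.inr hbq
          · exact Or.inl (Relation.ReflTransGen.tail ha ⟨hab, hR' ha, hb, hbq⟩)
      have := ih R' _ (Function.update g i (shadow off q k d)) (by omega)
        (linked_component G _ r) hK' (fun j => ?_) r Relation.ReflTransGen.refl
      · convert this using 1
        funext c
        by_cases hc : c.1 = i
        · obtain ⟨c₁, c₂⟩ := c
          obtain rfl : c₁ = i := hc
          simp [deploy]
        · simp [deploy, hc]
      · rcases eq_or_ne j i with rfl | hj
        · exact ⟨q, k, d, by simpa using hq.mono hsub, by simp⟩
        · obtain ⟨p, k', d', hp, he⟩ := hg j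
          exact ⟨p, k', d', by simpa [hj] using hp.mono hsub, by simpa [hj] using he⟩
    have hclimb : ∀ r ∈ R, Wins G (deploy g i (fun _ => x) r) r := fun r hr =>
      ho.wins_of_climb hoff hone hq hq0 hdq hd hd0 hnew hr
    have hdep : (fun c : ι × J => g c.1 r c.2) = deploy g i (g i r) r := by
      funext c
      unfold deploy
      split_ifs with hc
      · rw [hc]
      · rfl
    rw [hdep]
    by_cases he : esc
    · obtain ⟨j, hj⟩ := hK.cover he.1
      obtain rfl : j = i := by
        by_contra hne
        exact he.2 j hne hj
      obtain ⟨p, k', d', hp, hge⟩ := hg j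
      rw [hge]
      exact ho.wins_of_gather hp hj hclimb hr
    · exact ho.wins_of_walk hG he hclimb _ hr

/-- The cops win with one group of cops for each edge of `H - h` if the offsets in a group suit
`G`. -/
theorem surroundingCopNumber_le {V W J : Type*} [Finite V] [Fintype W] [Finite J]
    {G : SimpleGraph V} (hG : G.Connected) (H : SimpleGraph W) [DecidableRel H.Adj] (h : W)
    (hleaf : ∀ v, H.Adj h v → H.degree v ≠ 1) (hisol : ∀ v, v ≠ h → H.degree v ≠ 0)
    (hminor : ¬ HasMinor G H) {off : J → ℤ} (hs : Suits G off) (hoff : ∀ l, |off l| ≤ 1)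
    (hone : ∃ l, off l = 1) :
    surroundingCopNumber G ≤ Nat.card J * (H.induce {v | v ≠ h}).edgeSet.ncard := by
  classical
  let H' := H.induce {v | v ≠ h}
  -- A vertex other than `h` has a neighbour other than `h`.
  have hU : ∀ w : {v | v ≠ h}, ∃ i : H'.edgeSet, w ∈ i.1 := by
    rintro ⟨w, hw⟩
    obtain ⟨v, hwv, hvh⟩ : ∃ v, H.Adj w v ∧ v ≠ h := by
      by_contra! hno
      have hsub : H.neighborFinset w ⊆ {h} := by
        intro v hv
        rw [SimpleGraph.mem_neighborFinset] at hv
        simpa using hno v hv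
      have hdeg : H.degree w ≠ 0 := hisol w hw
      rcases Finset.subset_singleton_iff.1 hsub with he | he
      · rw [← SimpleGraph.card_neighborFinset_eq_degree, he] at hdeg
        exact hdeg rfl
      · have hadj : H.Adj w h := by rw [← SimpleGraph.mem_neighborFinset, he]; simp
        refine hleaf w hadj.symm ?_
        rw [← SimpleGraph.card_neighborFinset_eq_degree, he]
        rfl
    exact ⟨⟨s(⟨w, hw⟩, ⟨v, hvh⟩), hwv⟩, Sym2.mem_mk_left _ _⟩
  have hmin : ∀ R : Set V, R.Nonempty → Linked G R →
      ¬ HasModelAround G (fun i : H'.edgeSet => i.1) R := by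
    rintro R hRne hR ⟨B, hB, hdisj, havoid, hadj, hedge⟩
    refine hminor ⟨fun w => if hw : w ≠ h then B ⟨w, hw⟩ else R, ?_, ?_, ?_⟩
    · intro w
      refine Linked.connected ?_ ?_ <;> by_cases hw : w ≠ h
      · simpa only [dif_pos hw] using hB _
      · simpa only [dif_neg hw] using hR
      · obtain ⟨x, hx, -⟩ := hadj ⟨w, hw⟩
        exact ⟨x, by simpa only [dif_pos hw] using hx⟩
      · simpa only [dif_neg hw] using hRne
    · intro a b hab
      rw [Set.disjoint_left]
      intro v hva hvb
      by_cases ha : a ≠ h <;> by_cases hb : b ≠ h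
      · simp only [dif_pos ha, dif_pos hb] at hva hvb
        exact hab (congrArg Subtype.val (hdisj _ _ v hva hvb))
      · simp only [dif_pos ha, dif_neg hb] at hva hvb
        exact havoid _ v hva hvb
      · simp only [dif_neg ha, dif_pos hb] at hva hvb
        exact havoid _ v hvb hva
      · exact hab ((not_not.1 ha).trans (not_not.1 hb).symm)
    · intro a b hab
      by_cases ha : a ≠ h <;> by_cases hb : b ≠ h
      · simp only [dif_pos ha, dif_pos hb]
        exact hedge ⟨s(⟨a, ha⟩, ⟨b, hb⟩), hab⟩ _ _ rfl
      · simp only [dif_pos ha, dif_neg hb]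
        obtain ⟨x, hx, r, hr, hrx⟩ := hadj ⟨a, ha⟩
        exact ⟨x, hx, r, hr, hrx.symm⟩
      · simp only [dif_neg ha, dif_pos hb]
        obtain ⟨x, hx, r, hr, hrx⟩ := hadj ⟨b, hb⟩
        exact ⟨r, hr, x, hx, hrx⟩
      · exact (hab.ne ((not_not.1 ha).trans (not_not.1 hb).symm)).elim
  have := hG.nonempty
  let y : V := Classical.arbitrary V
  have hwin : ∀ r, Wins G (fun _ : H'.edgeSet × J => y) r := by
    intro r
    refine wins_of_confined hG hs hoff hone (edge := fun i : H'.edgeSet => i.1)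
      (fun i => H'.not_isDiag_of_mem_edgeSet i.2) hU hmin _ Set.univ (fun _ => ∅)
      (fun _ _ _ => y) le_rfl ?_ (confined_univ G _ _) (fun j => ?_) r trivial
    · intro a _ b _
      obtain ⟨w⟩ := hG.preconnected a b
      clear * - w
      induction w with
      | nil => exact .refl
      | cons hadj _ ih => exact .head ⟨hadj, trivial, trivial⟩ ih
    · refine ⟨fun _ => y, 0, fun _ => 0, ⟨le_rfl, fun z h₁ h₂ => by omega, by simp, by simp,
        by simp⟩, rfl⟩
  have hcard : Nat.card (H'.edgeSet × J) = Nat.card J * H'.edgeSet.ncard := by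
    rw [Nat.card_prod, Nat.card_coe_set_eq, mul_comm]
  exact Nat.find_min' _ (copsWin_of_wins (Finite.equivFinOfCardEq hcard).symm _ hwin)

end SurroundingGame

theorem mainTheorem7 {V W : Type*} [Finite V] [Fintype W]
    (G : SimpleGraph V) (hG : G.Connected)
    (H : SimpleGraph W) [DecidableRel H.Adj] (h : W)
    (hleaf : ∀ v, H.Adj h v → H.degree v ≠ 1)
    (hisol : ∀ v, v ≠ h → H.degree v ≠ 0)
    (hminor : ¬ SurroundingGame.HasMinor G H) :
    SurroundingGame.surroundingCopNumber G ≤ 3 * (H.induce {v | v ≠ h}).edgeSet.ncard ∧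
      (G.IsBipartite →
        SurroundingGame.surroundingCopNumber G ≤ 2 * (H.induce {v | v ≠ h}).edgeSet.ncard) := by
  refine ⟨?_, fun hb => ?_⟩
  · have := SurroundingGame.surroundingCopNumber_le hG H h hleaf hisol hminor
      (SurroundingGame.suits_three G) (fun l => by fin_cases l <;> simp) ⟨2, by simp⟩
    rwa [Nat.card_fin] at this
  · have := SurroundingGame.surroundingCopNumber_le hG H h hleaf hisol hminor
      (SurroundingGame.suits_two hb) (fun l => by fin_cases l <;> simp) ⟨1, by simp⟩
    rwa [Nat.card_fin] at this
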